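/- Let $K$ be a field of characteristic $0$. A compatible Leibniz algebra $(L,\pi_1,\pi_2)$ is a $K$-vector space $L$ with two bilinear operations $\pi_1(x,y)=[x,y]$ and $\pi_2(x,y)=\{x,y\}$ such that each of them satisfies the Leibniz identity $[x,[y,z]]=[[x,y],z]+[y,[x,z]]$ (resp. the same identity for $\{\,,\}$) and, for all $x,y,z\in L$, $$[x,\{y,z\}]+\{x,[y,z]\}=[\{x,y\},z]+\{[x,y],z\}+[y,\{x,z\}]+\{y,[x,z]\}.$$ Let $C^n(L,L)=\mathrm{Hom}_K(L^{\otimes n},L)$. For $P\in C^{p+1}(L,L)$ and $Q\in C^{q+1}(L,L)$ with $p,q\ge 0$, the Balavoine bracket is $[P,Q]_B=P\circ Q-(-1)^{pq}\,Q\circ P\in C^{p+q+1}(L,L)$, where $P\circ Q=\sum_{k=1}^{p+1}(-1)^{(k-1)q}\,P\circ_k Q$ and $$(P\circ_k Q)(x_1,\dots,x_{p+q+1})=\sum_{\sigma}(-1)^{\sigma}P\bigl(x_{\sigma(1)},\dots,x_{\sigma(k-1)},Q(x_{\sigma(k)},\dots,x_{\sigma(k+q-1)},x_{k+q}),x_{k+q+1},\dots,x_{p+q+1}\bigr),$$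 the sum being over the $(k-1,q)$-shuffles $\sigma$, i.e. the permutations $\sigma$ of $\{1,\dots,k+q-1\}$ with $\sigma(1)<\dots<\sigma(k-1)$ and $\sigma(k)<\dots<\sigma(k+q-1)$. Let $LC^n(L,L)$ be the direct sum of $n$ copies of $C^n(L,L)$ (so $LC^0(L,L)=0$), let $d^0=0$, and for $n\ge 1$ define the linear map $d^n:LC^n(L,L)\to LC^{n+1}(L,L)$ by $$d^n(f_1,\dots,f_n)=(-1)^{n-1}\bigl([\pi_1,f_1]_B,\ \dots,\ [\pi_2,f_{i-1}]_B+[\pi_1,f_i]_B,\ \dots,\ [\pi_2,f_n]_B\bigr),$$ where $i$ runs over $2\le i\le n$ (so $d^1f=([\pi_1,f]_B,[\pi_2,f]_B)$). **Theorem.** For every compatible Leibniz algebra $(L,\pi_1,\pi_2)$ one has $d^{n+1}\circ d^n=0$ for all $n\ge 0$. Hence $(LC^*(L,L),d)$ is a cochain complex: $\operatorname{im} d^{n-1}\subseteq\ker d^n$ (where $\operatorname{im} d^{-1}=0$), and its cohomology in degree $n$ is $H^n(L,L)=\ker d^n/\operatorname{im} d^{n-1}$. -/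

import Mathlib

namespace CompatibleLeibniz

universe u v

/-- The space `C^n(L, L) = Hom(L^{⊗ n}, L)` of `n`-cochains, as `n`-multilinear maps `L^n → L`. -/
abbrev Cochain (K : Type u) (L : Type v) [Field K] [AddCommGroup L] [Module K L] (n : ℕ) :
    Type v :=
  MultilinearMap K (fun _ : Fin n => L) L

section Bracket

variable {K : Type u} {L : Type v} [Field K] [AddCommGroup L] [Module K L]

/-- The tuple `(x₀, …, x_{k-1}, Q(x_k, …, x_{k+q}), x_{k+q+1}, …, x_{p+q})`, where `0 ≤ k ≤ p`
and all indices start at `0`. -/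
def insertArgs {p q N : ℕ} (h : p + q + 1 = N) (k : Fin (p + 1)) (Q : Cochain K L (q + 1))
    (x : Fin N → L) : Fin (p + 1) → L := fun j =>
  if j < k then x ⟨j, by omega⟩
  else if j = k then Q (fun t : Fin (q + 1) => x ⟨k + t, by omega⟩)
  else x ⟨j + q, by omega⟩

theorem insertArgs_update {p q N : ℕ} (h : p + q + 1 = N) (k : Fin (p + 1))
    (Q : Cochain K L (q + 1)) (x : Fin N → L) (m : Fin N) :
    ∃ (j : Fin (p + 1)) (g : L →ₗ[K] L), ∀ v : L,
      insertArgs h k Q (Function.update x m v) = Function.update (insertArgs h k Q x) j (g v) := by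
  rcases lt_or_ge (m : ℕ) k with hm | hm
  · refine ⟨⟨m, by omega⟩, LinearMap.id, fun v => ?_⟩
    funext j
    simp only [insertArgs, Function.update_apply, Fin.ext_iff, Fin.lt_def, LinearMap.id_apply]
    by_cases h1 : (j : ℕ) < k
    · simp [h1]
    · have e1 : ¬ ((j : ℕ) = m) := by omega
      have e2 : ¬ ((j : ℕ) + q = m) := by omega
      have e3 : ∀ t : Fin (q + 1), ¬ ((k : ℕ) + t = m) := fun t => by omega
      simp [h1, e1, e2, e3]
  · rcases le_or_gt (m : ℕ) (k + q) with hm2 | hm2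
    · refine ⟨k, Q.toLinearMap (fun t => x ⟨k + t, by omega⟩) ⟨m - k, by omega⟩, fun v => ?_⟩
      funext j
      simp only [insertArgs, Function.update_apply, Fin.ext_iff, Fin.lt_def]
      by_cases h1 : (j : ℕ) < k
      · have e1 : ¬ ((j : ℕ) = m) := by omega
        have e2 : ¬ ((j : ℕ) = k) := by omega
        simp [h1, e1, e2]
      · by_cases h2 : (j : ℕ) = k
        · simp only [h2, lt_irrefl, if_false, if_true, MultilinearMap.toLinearMap_apply]
          congr 1
          funext t
          simp only [Function.update_apply, Fin.ext_iff]
          have e : ((k : ℕ) + t = m) ↔ ((t : ℕ) = m - k) := by omega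
          simp [e]
        · have e1 : ¬ ((j : ℕ) + q = m) := by omega
          simp [h1, h2, e1]
    · refine ⟨⟨m - q, by omega⟩, LinearMap.id, fun v => ?_⟩
      funext j
      simp only [insertArgs, Function.update_apply, Fin.ext_iff, Fin.lt_def, LinearMap.id_apply]
      by_cases h1 : (j : ℕ) < k
      · have e1 : ¬ ((j : ℕ) = m) := by omega
        have e2 : ¬ ((j : ℕ) = m - q) := by omega
        simp [h1, e1, e2]
      · by_cases h2 : (j : ℕ) = k
        · have e2 : ¬ ((k : ℕ) = m - q) := by omega
          have e3 : ∀ t : Fin (q + 1), ¬ ((k : ℕ) + t = m) := fun t => by omega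
          simp [h2, e2, e3]
        · have e : ((j : ℕ) + q = m) ↔ ((j : ℕ) = m - q) := by omega
          simp [h1, h2, e]

/-- The cochain
`(x₀, …, x_{p+q}) ↦ P(x₀, …, x_{k-1}, Q(x_k, …, x_{k+q}), x_{k+q+1}, …, x_{p+q})`. -/
def insertAt {p q N : ℕ} (h : p + q + 1 = N) (k : Fin (p + 1))
    (P : Cochain K L (p + 1)) (Q : Cochain K L (q + 1)) : Cochain K L N where
  toFun x := P (insertArgs h k Q x)
  map_update_add' := by
    intro inst x m v w
    have hinst : inst = instDecidableEqFin N := Subsingleton.elim _ _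
    subst hinst
    obtain ⟨j, g, hg⟩ := insertArgs_update h k Q x m
    simp only [hg, map_add, MultilinearMap.map_update_add]
  map_update_smul' := by
    intro inst x m c v
    have hinst : inst = instDecidableEqFin N := Subsingleton.elim _ _
    subst hinst
    obtain ⟨j, g, hg⟩ := insertArgs_update h k Q x m
    simp only [hg, map_smul, MultilinearMap.map_update_smul]

/-- The `(i, j)`-shuffles. A permutation of the first `i + j` indices is regarded as a permutation
of `Fin N` (`i + j ≤ N`) that fixes all further indices; it is an `(i, j)`-shuffle if it is
increasing on the first `i` indices and on the next `j` indices. -/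
def shuffles (N i j : ℕ) : Set (Equiv.Perm (Fin N)) :=
  {σ | (∀ a b : Fin N, a < b → (b : ℕ) < i → σ a < σ b) ∧
    (∀ a b : Fin N, i ≤ (a : ℕ) → a < b → (b : ℕ) < i + j → σ a < σ b) ∧
    ∀ a : Fin N, i + j ≤ (a : ℕ) → σ a = a}

open Classical in
/-- The partial composition `P ∘ₖ Q`, with `k` counted from `0`, so that the shuffles are the
`(k, q)`-shuffles:
`∑_σ (-1)^σ P(x_{σ(0)}, …, x_{σ(k-1)}, Q(x_{σ(k)}, …, x_{σ(k+q-1)}, x_{k+q}), x_{k+q+1}, …)`. -/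
noncomputable def circAt {p q N : ℕ} (h : p + q + 1 = N) (k : Fin (p + 1))
    (P : Cochain K L (p + 1)) (Q : Cochain K L (q + 1)) : Cochain K L N :=
  ∑ σ : Equiv.Perm (Fin N) with σ ∈ shuffles N k q,
    ((Equiv.Perm.sign σ : ℤ) : K) • (insertAt h k P Q).domDomCongr σ

/-- The composition `P ∘ Q = ∑ₖ (-1)^{kq} P ∘ₖ Q`, `k = 0, …, p`, for `P ∈ C^{p+1}`,
`Q ∈ C^{q+1}`; the result lies in `C^{p+q+1}`. -/
noncomputable def circ {p q N : ℕ} (h : p + q + 1 = N)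
    (P : Cochain K L (p + 1)) (Q : Cochain K L (q + 1)) : Cochain K L N :=
  ∑ k : Fin (p + 1), (-1 : K) ^ ((k : ℕ) * q) • circAt h k P Q

/-- The Balavoine bracket `[P, Q]_B = P ∘ Q - (-1)^{pq} Q ∘ P` of `P ∈ C^{p+1}`,
`Q ∈ C^{q+1}`. -/
noncomputable def balavoine {p q N : ℕ} (h : p + q + 1 = N)
    (P : Cochain K L (p + 1)) (Q : Cochain K L (q + 1)) : Cochain K L N :=
  circ h P Q - (-1 : K) ^ (p * q) • circ ((congrArg (· + 1) (Nat.add_comm q p)).trans h) Q P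

/-- The value of `P ∘ₖ Q`, written out. -/
theorem circAt_apply {p q N : ℕ} (h : p + q + 1 = N) (k : Fin (p + 1))
    (P : Cochain K L (p + 1)) (Q : Cochain K L (q + 1)) (x : Fin N → L) :
    haveI := Classical.decPred (· ∈ shuffles N k q)
    circAt h k P Q x = ∑ σ : Equiv.Perm (Fin N) with σ ∈ shuffles N k q,
      ((Equiv.Perm.sign σ : ℤ) : K) • P (insertArgs h k Q (fun i => x (σ i))) := by
  simp only [circAt, sum_apply, smul_apply,
    MultilinearMap.domDomCongr_apply]
  rfl

theorem insertArgs_add {p q N : ℕ} (h : p + q + 1 = N) (k : Fin (p + 1))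
    (Q Q' : Cochain K L (q + 1)) (x : Fin N → L) :
    insertArgs h k (Q + Q') x = Function.update (insertArgs h k Q x) k
      (insertArgs h k Q x k + insertArgs h k Q' x k) := by
  funext j
  by_cases h2 : j = k
  · subst h2; simp [insertArgs]
  · simp [insertArgs, h2]

theorem insertArgs_smul {p q N : ℕ} (h : p + q + 1 = N) (k : Fin (p + 1)) (c : K)
    (Q : Cochain K L (q + 1)) (x : Fin N → L) :
    insertArgs h k (c • Q) x = Function.update (insertArgs h k Q x) k
      (c • insertArgs h k Q x k) := by
  funext j
  by_cases h2 : j = k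
  · subst h2; simp [insertArgs]
  · simp [insertArgs, h2]

theorem insertArgs_eq_update {p q N : ℕ} (h : p + q + 1 = N) (k : Fin (p + 1))
    (Q Q' : Cochain K L (q + 1)) (x : Fin N → L) :
    Function.update (insertArgs h k Q x) k (insertArgs h k Q' x k) = insertArgs h k Q' x := by
  funext j
  by_cases h2 : j = k
  · subst h2; simp
  · simp [insertArgs, h2]

theorem insertAt_add_right {p q N : ℕ} (h : p + q + 1 = N) (k : Fin (p + 1))
    (P : Cochain K L (p + 1)) (Q Q' : Cochain K L (q + 1)) :
    insertAt h k P (Q + Q') = insertAt h k P Q + insertAt h k P Q' := by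
  ext x
  simp only [insertAt, MultilinearMap.coe_mk, add_apply, insertArgs_add,
    MultilinearMap.map_update_add, insertArgs_eq_update]

theorem insertAt_smul_right {p q N : ℕ} (h : p + q + 1 = N) (k : Fin (p + 1)) (c : K)
    (P : Cochain K L (p + 1)) (Q : Cochain K L (q + 1)) :
    insertAt h k P (c • Q) = c • insertAt h k P Q := by
  ext x
  simp only [insertAt, MultilinearMap.coe_mk, smul_apply, insertArgs_smul,
    MultilinearMap.map_update_smul, insertArgs_eq_update]

theorem insertAt_add_left {p q N : ℕ} (h : p + q + 1 = N) (k : Fin (p + 1))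
    (P P' : Cochain K L (p + 1)) (Q : Cochain K L (q + 1)) :
    insertAt h k (P + P') Q = insertAt h k P Q + insertAt h k P' Q := rfl

theorem insertAt_smul_left {p q N : ℕ} (h : p + q + 1 = N) (k : Fin (p + 1)) (c : K)
    (P : Cochain K L (p + 1)) (Q : Cochain K L (q + 1)) :
    insertAt h k (c • P) Q = c • insertAt h k P Q := rfl

theorem balavoine_add_right {p q N : ℕ} (h : p + q + 1 = N)
    (P : Cochain K L (p + 1)) (Q Q' : Cochain K L (q + 1)) :
    balavoine h P (Q + Q') = balavoine h P Q + balavoine h P Q' := by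
  ext x
  simp only [balavoine, circ, circAt, insertAt_add_right, insertAt_add_left,
    sub_apply, add_apply, smul_apply,
    sum_apply, MultilinearMap.domDomCongr_apply, smul_add, Finset.sum_add_distrib]
  abel

theorem balavoine_smul_right {p q N : ℕ} (h : p + q + 1 = N) (c : K)
    (P : Cochain K L (p + 1)) (Q : Cochain K L (q + 1)) :
    balavoine h P (c • Q) = c • balavoine h P Q := by
  ext x
  simp only [balavoine, circ, circAt, insertAt_smul_right, insertAt_smul_left,
    sub_apply, smul_apply,
    sum_apply, MultilinearMap.domDomCongr_apply, smul_sub, Finset.smul_sum,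
    smul_comm _ c]

/-- `[P, -]_B` as a linear map `C^{q+1} → C^{p+q+1}`. -/
noncomputable def balavoineLeft {p : ℕ} (P : Cochain K L (p + 1)) {q N : ℕ}
    (h : p + q + 1 = N) : Cochain K L (q + 1) →ₗ[K] Cochain K L N where
  toFun Q := balavoine h P Q
  map_add' := balavoine_add_right h P
  map_smul' c Q := balavoine_smul_right h c P Q

end Bracket

/-- The (left) Leibniz identity `[x,[y,z]] = [[x,y],z] + [y,[x,z]]` for a bilinear operation
`π(x, y) = [x, y]`. -/
def IsLeibniz {K : Type u} {L : Type v} [Field K] [AddCommGroup L] [Module K L]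
    (π : Cochain K L 2) : Prop :=
  ∀ x y z : L, π ![x, π ![y, z]] = π ![π ![x, y], z] + π ![y, π ![x, z]]

end CompatibleLeibniz

open CompatibleLeibniz in
/-- A compatible Leibniz algebra structure on the vector space `L`: two Leibniz brackets
`π₁(x, y) = [x, y]`, `π₂(x, y) = {x, y}` satisfying the compatibility condition. -/
structure CompatibleLeibnizAlgebra (K : Type*) (L : Type*) [Field K] [AddCommGroup L]
    [Module K L] where
  π₁ : Cochain K L 2
  π₂ : Cochain K L 2
  leibniz₁ : IsLeibniz π₁
  leibniz₂ : IsLeibniz π₂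
  compatible : ∀ x y z : L,
    π₁ ![x, π₂ ![y, z]] + π₂ ![x, π₁ ![y, z]] =
      π₁ ![π₂ ![x, y], z] + π₂ ![π₁ ![x, y], z] + π₁ ![y, π₂ ![x, z]] + π₂ ![y, π₁ ![x, z]]

namespace CompatibleLeibnizAlgebra

open CompatibleLeibniz

universe u v

variable {K : Type u} {L : Type v} [Field K] [AddCommGroup L] [Module K L]

/-- `LC^n(L, L)`: the direct sum of `n` copies of `C^n(L, L)`; in particular `LC^0 = 0`. -/
abbrev LC (K : Type u) (L : Type v) [Field K] [AddCommGroup L] [Module K L] (n : ℕ) : Type v :=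
  Fin n → Cochain K L n

/-- The differential `d^n : LC^n → LC^{n+1}`,
`d^n (f₁, …, fₙ) = (-1)^{n-1} ([π₁, f₁], …, [π₂, f_{i-1}] + [π₁, f_i], …, [π₂, fₙ])`;
for `n = 0` it is the zero map from `LC^0 = 0`. -/
noncomputable def d (A : CompatibleLeibnizAlgebra K L) : (n : ℕ) → LC K L n →ₗ[K] LC K L (n + 1)
  | 0 => 0
  | q + 1 =>
    { toFun := fun f i => (-1 : K) ^ q •
        ((if hi : 0 < (i : ℕ) then
            balavoineLeft (p := 1) A.π₂ (by omega) (f ⟨i - 1, by omega⟩) else 0) +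
          (if hi : (i : ℕ) < q + 1 then
            balavoineLeft (p := 1) A.π₁ (by omega) (f ⟨i, hi⟩) else 0))
      map_add' := by
        intro f g
        funext i
        simp only [Pi.add_apply, map_add]
        rw [← smul_add]
        congr 1
        split_ifs <;> abel
      map_smul' := by
        intro c f
        funext i
        simp only [Pi.smul_apply, map_smul, RingHom.id_apply]
        rw [smul_comm c]
        congr 1
        split_ifs <;> simp }

/-- The `n`-cocycles `ker d^n`. -/
noncomputable def cocycles (A : CompatibleLeibnizAlgebra K L) (n : ℕ) : Submodule K (LC K L n) :=
  LinearMap.ker (A.d n)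

/-- The `n`-coboundaries: the image of `d^{n-1}`, and `0` for `n = 0`. -/
noncomputable def coboundaries (A : CompatibleLeibnizAlgebra K L) :
    (n : ℕ) → Submodule K (LC K L n)
  | 0 => ⊥
  | n + 1 => LinearMap.range (A.d n)

/-- The cohomology `H^n(L, L)`: cocycles modulo coboundaries. -/
abbrev Cohomology (A : CompatibleLeibnizAlgebra K L) (n : ℕ) : Type v :=
  A.cocycles n ⧸ (A.coboundaries n).submoduleOf (A.cocycles n)

/-- The cochain complex `(LC^*(L, L), d)`, once `d ∘ d = 0` is known. -/
noncomputable def complex (A : CompatibleLeibnizAlgebra K L)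
    (hd : ∀ n : ℕ, A.d (n + 1) ∘ₗ A.d n = 0) : CochainComplex (ModuleCat.{v} K) ℕ :=
  CochainComplex.of (fun n => ModuleCat.of K (LC K L n)) (fun n => ModuleCat.ofHom (A.d n))
    (fun n => by rw [← ModuleCat.ofHom_comp, hd n]; rfl)

end CompatibleLeibnizAlgebra

/-! For a single Leibniz bracket `π`, the operator `[π, -]_B` is, up to the sign `(-1)^q` on
`C^{q+1}`, the Leibniz coboundary `δ` with adjoint coefficients (`balavoine_eq_coboundary`). So the
graded Jacobi identity of the Balavoine bracket is not needed. It is enough to prove `δ² = 0`, and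
this follows from Cartan calculus: if `δ` is defined recursively by `ι_y δ = 𝓛_y - δ ι_y`, then
`[𝓛_x, 𝓛_y] = 𝓛_{[x,y]}` and `[𝓛_x, δ] = 0` yield `δ² = 0` by induction on the degree.

The two brackets are handled by polarization. Compatibility says exactly that `π₁ + π₂` is again
Leibniz. Expanding `[π₁ + π₂, [π₁ + π₂, f]] = 0` and removing the pure terms leaves `[π₁, [π₂, f]] +
[π₂, [π₁, f]] = 0`. Each component of `d (d f)` is, up to sign, a sum of pure terms and of such
mixed pairs. -/

namespace CompatibleLeibniz

universe u v

/-! ### Cartan calculus for a Leibniz bracket. -/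

section Cartan

variable {K : Type u} {L : Type v} [Field K] [AddCommGroup L] [Module K L]

theorem curryLeft_add {n : ℕ} (f g : Cochain K L (n + 1)) :
    (f + g).curryLeft = f.curryLeft + g.curryLeft := rfl

theorem curryLeft_sub {n : ℕ} (f g : Cochain K L (n + 1)) :
    (f - g).curryLeft = f.curryLeft - g.curryLeft := rfl

theorem curryLeft_smul {n : ℕ} (c : K) (f : Cochain K L (n + 1)) :
    (c • f).curryLeft = c • f.curryLeft := rfl

/-- The Lie derivative `𝓛ₓ` on cochains along a bilinear operation `b`, defined by recursion through
`𝓛ₓ a = b x a` in degree `0` and `ι_y 𝓛ₓ f = 𝓛ₓ ι_y f - ι_{b x y} f`. -/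
noncomputable def lieDer (b : L →ₗ[K] L →ₗ[K] L) :
    (n : ℕ) → L →ₗ[K] Cochain K L n →ₗ[K] Cochain K L n
  | 0 => LinearMap.mk₂ K (fun x f => (b x).compMultilinearMap f)
      (by intros; ext; simp) (by intros; ext; simp) (by intros; ext; simp) (by intros; ext; simp)
  | n + 1 => LinearMap.mk₂ K
      (fun x f => LinearMap.uncurryLeft (lieDer b n x ∘ₗ f.curryLeft - f.curryLeft ∘ₗ b x))
      (by intros; ext; simp; abel) (by intros; ext; simp [smul_sub])
      (by intros; ext; simp [curryLeft_add]; abel) (by intros; ext; simp [smul_sub, curryLeft_smul])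

/-- The Leibniz coboundary of cochains with values in the adjoint representation, defined by
recursion through `ι_y δ a = -b a y` in degree `0` and Cartan's formula `ι_y δ = 𝓛_y - δ ι_y`. -/
noncomputable def coboundary (b : L →ₗ[K] L →ₗ[K] L) :
    (n : ℕ) → Cochain K L n →ₗ[K] Cochain K L (n + 1)
  | 0 =>
    { toFun := fun f => LinearMap.uncurryLeft
        ((MultilinearMap.constLinearEquivOfIsEmpty K K (fun _ : Fin 0 => L) L).toLinearMap ∘ₗ (-b (f ![])))
      map_add' := by intros; ext; simp; abel
      map_smul' := by intros; ext; simp }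
  | n + 1 =>
    { toFun := fun f => LinearMap.uncurryLeft
        ((lieDer b (n + 1)).flip f - coboundary b n ∘ₗ f.curryLeft)
      map_add' := by intros; ext; simp [curryLeft_add]; abel
      map_smul' := by intros; ext; simp [smul_sub, curryLeft_smul] }

variable (b : L →ₗ[K] L →ₗ[K] L)

theorem cochain_ext_curryLeft {n : ℕ} {f g : Cochain K L (n + 1)}
    (h : ∀ x, f.curryLeft x = g.curryLeft x) : f = g := by
  rw [← f.uncurry_curryLeft, ← g.uncurry_curryLeft]
  exact congrArg _ (LinearMap.ext h)

theorem lieDer_zero_apply (x : L) (f : Cochain K L 0) (m : Fin 0 → L) :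
    lieDer b 0 x f m = b x (f m) := rfl

theorem lieDer_curryLeft {n : ℕ} (x y : L) (f : Cochain K L (n + 1)) :
    (lieDer b (n + 1) x f).curryLeft y =
      lieDer b n x (f.curryLeft y) - f.curryLeft (b x y) := by
  simp [lieDer]

theorem coboundary_zero_apply (f : Cochain K L 0) (m : Fin 1 → L) :
    coboundary b 0 f m = -b (f ![]) (m 0) := by
  simp [coboundary]

theorem coboundary_curryLeft {n : ℕ} (y : L) (f : Cochain K L (n + 1)) :
    (coboundary b (n + 1) f).curryLeft y =
      lieDer b (n + 1) y f - coboundary b n (f.curryLeft y) := by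
  simp [coboundary]

theorem lieDer_zero_coboundary_zero (y : L) (f : Cochain K L 0) (m : Fin 0 → L) :
    (coboundary b 0 f).curryLeft y m = -b (f ![]) y := by
  simp [coboundary]

variable {b} (hb : ∀ x y z, b x (b y z) = b (b x y) z + b y (b x z))
include hb

/-- In degree `0` this is the Leibniz identity for values. In the inductive step the Leibniz
identity is used again, for the contracted argument `z`. -/
theorem lieDer_lieDer (n : ℕ) (x y : L) (f : Cochain K L n) :
    lieDer b n x (lieDer b n y f) = lieDer b n (b x y) f + lieDer b n y (lieDer b n x f) := by
  induction n with
  | zero => ext m; simp [lieDer_zero_apply, hb x y]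
  | succ n ih =>
    refine cochain_ext_curryLeft fun z => ?_
    have h := ih (f.curryLeft z)
    simp only [curryLeft_add, LinearMap.add_apply, lieDer_curryLeft, map_sub,
      hb x y z, h, map_add]
    abel

/-- Contracting with `y` turns the difference of the two sides into `[𝓛_x, 𝓛_y] - 𝓛_{[x,y]}` plus
the same claim for `ι_y f`. -/
theorem lieDer_coboundary (n : ℕ) (x : L) (f : Cochain K L n) :
    lieDer b (n + 1) x (coboundary b n f) = coboundary b n (lieDer b n x f) := by
  induction n with
  | zero =>
    refine cochain_ext_curryLeft fun y => ?_
    ext m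
    rw [lieDer_curryLeft]
    simp only [sub_apply, lieDer_zero_apply, lieDer_zero_coboundary_zero, map_neg, hb x]
    abel
  | succ n ih =>
    refine cochain_ext_curryLeft fun y => ?_
    simp only [lieDer_curryLeft, coboundary_curryLeft, map_sub, ih, lieDer_lieDer hb _ x y]
    abel

/-- By Cartan's formula used twice, `ι_x δ² = 𝓛_x δ - δ 𝓛_x + δ² ι_x`: the commutator vanishes and
the last term has lower degree. -/
theorem coboundary_coboundary (n : ℕ) (f : Cochain K L n) :
    coboundary b (n + 1) (coboundary b n f) = 0 := by
  induction n with
  | zero =>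
    refine cochain_ext_curryLeft fun x => cochain_ext_curryLeft fun y => ?_
    ext m
    rw [coboundary_curryLeft]
    have h := hb (f ![]) x y
    simp only [curryLeft_sub, LinearMap.sub_apply, lieDer_curryLeft,
      lieDer_zero_coboundary_zero, sub_apply, lieDer_zero_apply, map_neg, h,
      LinearMap.neg_apply]
    simp
  | succ n ih =>
    refine cochain_ext_curryLeft fun x => ?_
    rw [coboundary_curryLeft, coboundary_curryLeft, map_sub, ih, lieDer_coboundary hb, sub_zero,
      sub_self]
    rfl

end Cartan

/-! ### The shuffles that occur when one factor is binary. -/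

section Shuffles

/-- The permutation that maps `k` to `i` and is increasing on the complement of `k`. -/
def insertPerm {m : ℕ} (k i : Fin (m + 1)) : Equiv.Perm (Fin (m + 1)) :=
  k.cycleRange.trans i.cycleRange.symm

variable {m : ℕ} (k i : Fin (m + 1))

@[simp]
theorem insertPerm_self : insertPerm k i k = i := by
  simp [insertPerm]

@[simp]
theorem insertPerm_succAbove (j : Fin m) : insertPerm k i (k.succAbove j) = i.succAbove j := by
  simp [insertPerm]

theorem sign_insertPerm :
    ((Equiv.Perm.sign (insertPerm k i) : ℤˣ) : ℤ) = (-1) ^ (k + i : ℕ) := by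
  have h : insertPerm k i = i.cycleRange⁻¹ * k.cycleRange := rfl
  simp [h, Fin.sign_cycleRange, pow_add, mul_comm]

theorem insertPerm_self_self : insertPerm k k = 1 := by
  ext j
  rcases Fin.eq_self_or_eq_succAbove k j with rfl | ⟨j, rfl⟩ <;> simp

/-- A strictly increasing map on `Fin m` is determined by its range, which here is the complement of
`σ k`. -/
theorem eq_insertPerm {σ : Equiv.Perm (Fin (m + 1))} (h : StrictMono (σ ∘ k.succAbove)) :
    σ = insertPerm k (σ k) := by
  have hr : σ ∘ k.succAbove = (σ k).succAbove := by
    refine (h.range_inj (Fin.strictMono_succAbove _)).mp ?_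
    rw [Set.range_comp, Fin.range_succAbove, Fin.range_succAbove, Set.image_compl_eq σ.bijective,
      Set.image_singleton]
  ext j
  rcases Fin.eq_self_or_eq_succAbove k j with rfl | ⟨j, rfl⟩
  · simp
  · rw [insertPerm_succAbove, ← hr]; rfl

theorem mem_shuffles_one {σ : Equiv.Perm (Fin (m + 1))} :
    σ ∈ shuffles (m + 1) k 1 ↔ ∃ i ≤ k, σ = insertPerm k i := by
  constructor
  · rintro ⟨h1, -, h3⟩
    -- If `σ a > k`, then `σ` fixes `σ a`, so injectivity gives `σ a = a ≤ k`.
    have hle : ∀ a ≤ k, σ a ≤ k := by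
      intro a ha
      by_contra! hlt
      have := σ.injective (h3 (σ a) (by rw [Fin.lt_def] at hlt; omega))
      omega
    refine ⟨σ k, hle k le_rfl, eq_insertPerm k ?_⟩
    intro a b hab
    simp only [Function.comp_apply]
    have hab' := Fin.strictMono_succAbove k hab
    have hk : k.succAbove b ≠ k := Fin.succAbove_ne k b
    have hk' : k.succAbove a ≠ k := Fin.succAbove_ne k a
    generalize k.succAbove a = a' at *
    generalize k.succAbove b = b' at *
    rcases lt_or_ge b' k with hb | hb
    · exact h1 a' b' hab' hb
    · have hb' : k < b' := lt_of_le_of_ne hb hk.symm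
      rw [h3 b' (by rw [Fin.lt_def] at hb'; omega)]
      rcases lt_or_ge a' k with ha | ha
      · exact (hle a' ha.le).trans_lt hb'
      · have ha' : k < a' := lt_of_le_of_ne ha hk'.symm
        rwa [h3 a' (by rw [Fin.lt_def] at ha'; omega)]
  · rintro ⟨i, hi, rfl⟩
    refine ⟨fun a b hab hb => ?_, fun a b _ _ _ => by omega, fun a ha => ?_⟩
    · obtain ⟨a', rfl⟩ := Fin.exists_succAbove_eq (show a ≠ k by rintro rfl; omega)
      obtain ⟨b', rfl⟩ := Fin.exists_succAbove_eq (show b ≠ k by rintro rfl; omega)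
      simpa using hab
    · obtain ⟨a', rfl⟩ := Fin.exists_succAbove_eq (show a ≠ k by rintro rfl; omega)
      rw [insertPerm_succAbove]
      simp only [Fin.succAbove, Fin.lt_def, Fin.ext_iff, Fin.le_def] at *
      split_ifs at * <;> simp at * <;> omega

/-- Such a shuffle is determined by its value at `0`. The last index is fixed, so this value ranges
over `Fin (q + 1)` only, whence `castSucc`. -/
theorem mem_shuffles_one_left {q : ℕ} {σ : Equiv.Perm (Fin (q + 2))} :
    σ ∈ shuffles (q + 2) 1 q ↔ ∃ i : Fin (q + 1), σ = insertPerm 0 i.castSucc := by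
  constructor
  · rintro ⟨-, h2, h3⟩
    have hl : σ (Fin.last _) = Fin.last _ := h3 _ (by simp; omega)
    have h0 : σ 0 ≠ Fin.last _ := by
      rw [← hl]
      exact fun h => absurd (σ.injective h) (by simp [Fin.ext_iff])
    refine ⟨(σ 0).castPred h0, ?_⟩
    rw [Fin.castSucc_castPred]
    refine eq_insertPerm 0 fun a b hab => ?_
    simp only [Function.comp_apply, Fin.succAbove_zero]
    rcases eq_or_ne b (Fin.last _) with rfl | hb
    · rw [Fin.succ_last, hl, Fin.lt_last_iff_ne_last, ← hl]
      exact fun h => absurd (σ.injective h) (by simp [Fin.ext_iff, Fin.lt_def] at hab ⊢; omega)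
    · exact h2 _ _ (by simp) (by simpa using hab) (by simp [Fin.ext_iff] at hb ⊢; omega)
  · rintro ⟨i, rfl⟩
    refine ⟨fun a b hab hb => ?_, fun a b ha hab _ => ?_, fun a ha => ?_⟩
    · rw [Fin.lt_def] at hab; omega
    · obtain ⟨a', rfl⟩ := Fin.exists_succ_eq.mpr (show a ≠ 0 by rintro rfl; simp at ha)
      obtain ⟨b', rfl⟩ := Fin.exists_succ_eq.mpr (show b ≠ 0 by rintro rfl; simp at hab)
      rw [← Fin.succAbove_zero, insertPerm_succAbove, insertPerm_succAbove]
      exact Fin.strictMono_succAbove _ (by simpa using hab)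
    · obtain rfl : a = Fin.last _ := by ext; simp; omega
      rw [← Fin.succ_last, ← Fin.succAbove_zero, insertPerm_succAbove]
      simp [Fin.succAbove, Fin.lt_def]
      omega

theorem mem_shuffles_zero {q : ℕ} {σ : Equiv.Perm (Fin (q + 2))} :
    σ ∈ shuffles (q + 2) 0 q ↔ σ = 1 := by
  constructor
  · rintro ⟨-, h2, h3⟩
    have hl : σ (Fin.last _) = Fin.last _ := h3 _ (by simp)
    have hl' : σ (Fin.last _).castSucc = (Fin.last _).castSucc := h3 _ (by simp)
    rw [eq_insertPerm (σ := σ) (Fin.last _), hl, insertPerm_self_self]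
    intro a b hab
    simp only [Function.comp_apply, Fin.succAbove_last]
    rcases eq_or_ne b (Fin.last _) with rfl | hb
    · rw [hl']
      have h1 : σ a.castSucc ≠ Fin.last _ := by
        rw [← hl]
        exact fun h => absurd (σ.injective h) (by simp [Fin.ext_iff]; omega)
      have h2 : σ a.castSucc ≠ (Fin.last _).castSucc := by
        rw [← hl']
        exact fun h => absurd (σ.injective h) (by simp [Fin.ext_iff, Fin.lt_def] at hab ⊢; omega)
      simp only [ne_eq, Fin.ext_iff, Fin.lt_def, Fin.val_last, Fin.val_castSucc] at *
      omega
    · exact h2 _ _ (by simp) (by simpa using hab) (by simp [Fin.ext_iff] at hb ⊢; omega)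
  · rintro rfl
    exact ⟨fun a b hab _ => hab, fun a b _ hab _ => hab, fun a _ => rfl⟩

end Shuffles

/-! ### Closed formulas, and the Balavoine bracket as a coboundary. -/

section Formulas

variable {K : Type u} {L : Type v} [Field K] [AddCommGroup L] [Module K L]

/-- The separate `j` allows the position to be written as the value of an element of another `Fin`,
as happens in `circ_two_right`. -/
theorem sum_shuffles_one {m : ℕ} (k : Fin (m + 1)) (j : ℕ) (hj : j = k) {M : Type*}
    [AddCommMonoid M]
    [DecidablePred (· ∈ shuffles (m + 1) j 1)] (g : Equiv.Perm (Fin (m + 1)) → M) :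
    ∑ σ with σ ∈ shuffles (m + 1) j 1, g σ = ∑ i ∈ Finset.Iic k, g (insertPerm k i) := by
  classical
  subst hj
  have : Function.Injective (insertPerm k) := fun i j h => by
    simpa using congrArg (· k) h
  rw [← Finset.sum_image this.injOn]
  congr 1
  ext σ
  simp [mem_shuffles_one, eq_comm]

theorem sum_shuffles_one_left {q : ℕ} {M : Type*} [AddCommMonoid M]
    [DecidablePred (· ∈ shuffles (q + 2) 1 q)] (g : Equiv.Perm (Fin (q + 2)) → M) :
    ∑ σ with σ ∈ shuffles (q + 2) 1 q, g σ = ∑ i : Fin (q + 1), g (insertPerm 0 i.castSucc) := by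
  classical
  have : Function.Injective fun i : Fin (q + 1) => insertPerm 0 i.castSucc := fun i j h => by
    simpa using congrArg (· 0) h
  rw [← Finset.sum_image (f := g) this.injOn]
  congr 1
  ext σ
  simp [mem_shuffles_one_left, eq_comm]

theorem sum_shuffles_zero {q : ℕ} {M : Type*} [AddCommMonoid M]
    [DecidablePred (· ∈ shuffles (q + 2) 0 q)] (g : Equiv.Perm (Fin (q + 2)) → M) :
    ∑ σ with σ ∈ shuffles (q + 2) 0 q, g σ = g 1 := by
  rw [← Finset.sum_singleton g 1]
  congr 1
  ext σ
  simp [mem_shuffles_zero]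

/-- A `2`-cochain as a bilinear map. -/
noncomputable def bilin (π : Cochain K L 2) : L →ₗ[K] L →ₗ[K] L :=
  LinearMap.mk₂ K (fun x y => π ![x, y])
    (fun x x' y => MultilinearMap.cons_add π ![y] x x')
    (fun c x y => MultilinearMap.cons_smul π ![y] c x)
    (fun x y y' => MultilinearMap.cons_add (π.curryLeft x) ![] y y')
    (fun c x y => MultilinearMap.cons_smul (π.curryLeft x) ![] c y)

@[simp]
theorem bilin_apply (π : Cochain K L 2) (x y : L) : bilin π x y = π ![x, y] := rfl

theorem lieDer_apply (b : L →ₗ[K] L →ₗ[K] L) {n : ℕ} (a : L) (f : Cochain K L n) (y : Fin n → L) :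
    lieDer b n a f y = b a (f y) - ∑ k, f (Function.update y k (b a (y k))) := by
  induction n with
  | zero => simp [lieDer_zero_apply]
  | succ n ih =>
    obtain ⟨z, t, rfl⟩ : ∃ z t, y = Fin.cons z t := ⟨_, _, (Fin.cons_self_tail y).symm⟩
    have h := congrArg (· t) (lieDer_curryLeft b a z f)
    simp only [MultilinearMap.curryLeft_apply, sub_apply, ih] at h
    rw [h, Fin.sum_univ_succ]
    simp only [Fin.cons_zero, Fin.cons_succ, Fin.update_cons_zero, Fin.cons_update]
    abel

/-- The recursion unrolled: the `i = 0` summand is `𝓛` along the first argument, and `-δ ι` shifts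
the remaining indices and flips their signs. -/
theorem coboundary_apply (b : L →ₗ[K] L →ₗ[K] L) {n : ℕ} (f : Cochain K L n)
    (x : Fin (n + 1) → L) :
    coboundary b n f x =
      ∑ i : Fin n, (-1 : K) ^ (i : ℕ) •
        (b (x i.castSucc) (f fun j => x (i.castSucc.succAbove j)) -
          ∑ k : Fin n, if i ≤ k then f (Function.update (fun j => x (i.castSucc.succAbove j)) k
            (b (x i.castSucc) (x k.succ))) else 0) -
      (-1 : K) ^ n • b (f fun j => x j.castSucc) (x (Fin.last n)) := by
  induction n with
  | zero =>
    rw [coboundary_zero_apply, Subsingleton.elim (fun j : Fin 0 => x j.castSucc) ![]]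
    simp
  | succ n ih =>
    obtain ⟨a, y, rfl⟩ : ∃ a y, x = Fin.cons a y := ⟨_, _, (Fin.cons_self_tail x).symm⟩
    have h := congrArg (· y) (coboundary_curryLeft b a f)
    simp only [MultilinearMap.curryLeft_apply, sub_apply, ih, lieDer_apply] at h
    have hc : ∀ i : Fin n, (fun j => (Fin.cons a y : Fin (n + 2) → L)
        (i.castSucc.succ.succAbove j)) = Fin.cons a fun j => y (i.castSucc.succAbove j) := by
      intro i
      funext j
      refine Fin.cases ?_ (fun j => ?_) j <;> simp
    have hi : (fun j : Fin (n + 1) => (Fin.cons a y : Fin (n + 2) → L) j.castSucc) =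
        Fin.cons a fun j => y j.castSucc := by
      funext j
      refine Fin.cases ?_ (fun j => ?_) j <;> simp
    have hs : ∀ (i : Fin n) (g : Fin (n + 1) → L), (∑ k, if i.succ ≤ k then g k else 0) =
        ∑ k : Fin n, if i ≤ k then g k.succ else 0 := by
      intro i g
      rw [Fin.sum_univ_succ, if_neg (Fin.not_le.mpr i.succ_pos), zero_add]
      simp only [Fin.succ_le_succ_iff]
    rw [hi, Fin.sum_univ_succ, h]
    simp only [hc, hs, Fin.castSucc_zero, Fin.succAbove_zero, Fin.cons_zero, Fin.cons_succ,
      Fin.zero_le, if_true, Fin.val_zero, pow_zero, one_smul, ← Fin.succ_castSucc, ← Fin.succ_last,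
      Fin.cons_update, Fin.val_succ, pow_succ, mul_neg, mul_one, neg_smul, Finset.sum_neg_distrib]
    abel

theorem circ_apply {p q N : ℕ} (h : p + q + 1 = N) (P : Cochain K L (p + 1))
    (Q : Cochain K L (q + 1)) (x : Fin N → L)
    [∀ k, DecidablePred (· ∈ shuffles N k q)] :
    circ h P Q x = ∑ k : Fin (p + 1), (-1 : K) ^ ((k : ℕ) * q) •
      ∑ σ with σ ∈ shuffles N k q,
        ((Equiv.Perm.sign σ : ℤ) : K) • P (insertArgs h k Q fun i => x (σ i)) := by
  simp only [circ, sum_apply, smul_apply, circAt_apply]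
  refine Finset.sum_congr rfl fun k _ => ?_
  congr!

theorem circ_two_left {q : ℕ} (h : 1 + q + 1 = q + 2) (π : Cochain K L 2)
    (f : Cochain K L (q + 1)) (x : Fin (q + 2) → L) :
    circ h π f x = π ![f fun j => x j.castSucc, x (Fin.last _)] +
      (-1 : K) ^ q • ∑ i : Fin (q + 1), (-1 : K) ^ (i : ℕ) •
        π ![x i.castSucc, f fun j => x (i.castSucc.succAbove j)] := by
  classical
  rw [circ_apply, Fin.sum_univ_succ, Fin.sum_univ_one]
  simp only [Fin.val_zero, Fin.val_succ, zero_add, sum_shuffles_zero, sum_shuffles_one_left,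
    zero_mul, one_mul, pow_zero, one_smul, Equiv.Perm.sign_one, Units.val_one, Int.cast_one]
  congr 1
  · congr 1
    funext j
    refine Fin.cases ?_ (fun j => ?_) j
    · simp [insertArgs]
      rfl
    · obtain rfl : j = 0 := Subsingleton.elim _ _
      simp [insertArgs]
      congr 1; ext; simp; omega
  · congr 1
    refine Finset.sum_congr rfl fun i _ => ?_
    rw [sign_insertPerm]
    congr 1
    · simp
    · congr 1
      funext j
      refine Fin.cases ?_ (fun j => ?_) j
      · simp [insertArgs]
      · obtain rfl : j = 0 := Subsingleton.elim _ _
        simp [insertArgs]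
        congr 1
        funext t
        rw [← insertPerm_succAbove 0]
        congr 2
        ext; simp; omega

theorem circ_two_right {q : ℕ} (h : q + 1 + 1 = q + 2) (π : Cochain K L 2)
    (f : Cochain K L (q + 1)) (x : Fin (q + 2) → L) :
    circ h f π x = ∑ i : Fin (q + 1), (-1 : K) ^ (i : ℕ) •
      ∑ k : Fin (q + 1), if i ≤ k then f (Function.update (fun j => x (i.castSucc.succAbove j)) k
            (π ![x i.castSucc, x k.succ])) else 0 := by
  simp only [Finset.smul_sum]
  -- The composition sums over the insertion slot `k` first and the shuffle `i ≤ k` second, the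
  -- reverse of the order in `coboundary_apply`.
  rw [Finset.sum_comm]
  classical
  rw [circ_apply]
  refine Finset.sum_congr rfl fun k _ => ?_
  refine (congrArg _ (sum_shuffles_one (m := q + 1) k.castSucc k rfl _)).trans ?_
  rw [Finset.smul_sum, ← Fin.map_castSuccEmb_Iic,
    Finset.sum_map]
  simp only [smul_ite, smul_zero]
  rw [← Finset.sum_filter]
  refine Finset.sum_congr (by ext; simp) fun i hi => ?_
  have hi : i ≤ k := by simpa using hi
  rw [sign_insertPerm, smul_smul]
  congr 1
  -- The composition sign `(-1)^k` times the shuffle sign `(-1)^(k + i)` is `(-1)^i`.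
  · push_cast
    rw [← pow_add]
    simp [← add_assoc, pow_add, ← mul_pow]
  · congr 1
    funext j
    rcases lt_trichotomy j k with hj | rfl | hj
    · rw [Function.update_of_ne hj.ne, insertArgs, if_pos hj, ← insertPerm_succAbove k.castSucc,
        Fin.succAbove_castSucc_of_lt _ _ hj]
      rfl
    · rw [Function.update_self, insertArgs, if_neg (lt_irrefl _), if_pos rfl]
      congr 1
      funext t
      refine Fin.cases ?_ (fun t => ?_) t
      · exact congrArg x (insertPerm_self j.castSucc i.castSucc)
      · obtain rfl : t = 0 := Subsingleton.elim _ _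
        have e := insertPerm_succAbove j.castSucc i.castSucc j
        rw [Fin.succAbove_castSucc_self, Fin.succAbove_castSucc_of_le _ _ hi] at e
        exact congrArg x e
    · rw [Function.update_of_ne hj.ne', insertArgs, if_neg hj.not_gt, if_neg hj.ne',
        ← insertPerm_succAbove k.castSucc, Fin.succAbove_castSucc_of_le _ _ hj.le]
      rfl

/-- Left multiplications and the final right multiplication come from `π ∘ f`; the terms with a
bracket inside `f` come from `f ∘ π`. -/
theorem balavoine_eq_coboundary {q : ℕ} (h : 1 + q + 1 = q + 2) (π : Cochain K L 2)
    (f : Cochain K L (q + 1)) :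
    balavoine h π f = (-1 : K) ^ q • coboundary (bilin π) (q + 1) f := by
  ext x
  rw [smul_apply, coboundary_apply]
  simp only [balavoine, sub_apply, smul_apply, circ_two_left, circ_two_right, one_mul, bilin_apply,
    smul_sub, Finset.sum_sub_distrib]
  rw [smul_smul, ← pow_add]
  have : (-1 : K) ^ (q + (q + 1)) = -1 := by rw [← add_assoc, pow_succ, ← two_mul]; simp
  rw [this, neg_smul, one_smul]
  abel

theorem balavoine_add_left {p q N : ℕ} (h : p + q + 1 = N)
    (P P' : Cochain K L (p + 1)) (Q : Cochain K L (q + 1)) :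
    balavoine h (P + P') Q = balavoine h P Q + balavoine h P' Q := by
  ext x
  simp only [balavoine, circ, circAt, insertAt_add_right, insertAt_add_left,
    sub_apply, add_apply, smul_apply,
    sum_apply, MultilinearMap.domDomCongr_apply, smul_add, Finset.sum_add_distrib]
  abel

theorem balavoine_balavoine {π : Cochain K L 2} (hπ : IsLeibniz π) {q : ℕ}
    (h : 1 + q + 1 = q + 2) (h' : 1 + (q + 1) + 1 = q + 1 + 2) (f : Cochain K L (q + 1)) :
    balavoine h' π (balavoine h π f) = 0 := by
  rw [balavoine_eq_coboundary, balavoine_eq_coboundary, map_smul,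
    coboundary_coboundary (b := bilin π) hπ, smul_zero, smul_zero]

end Formulas

end CompatibleLeibniz

/-! ### Polarization, `d ∘ d = 0`, and cohomology. -/

namespace CompatibleLeibnizAlgebra

open CompatibleLeibniz

universe u v

variable {K : Type u} {L : Type v} [Field K] [AddCommGroup L] [Module K L]

theorem isLeibniz_add (A : CompatibleLeibnizAlgebra K L) : IsLeibniz (A.π₁ + A.π₂) := by
  intro x y z
  have add (π : Cochain K L 2) (a b c : L) : π ![a, b + c] = π ![a, b] + π ![a, c] :=
    (bilin π a).map_add b c
  have add' (π : Cochain K L 2) (a b c : L) : π ![a + b, c] = π ![a, c] + π ![b, c] :=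
    (bilin π).map_add₂ a b c
  simp only [add_apply, add, add']
  rw [A.leibniz₁ x y z, A.leibniz₂ x y z]
  have h := A.compatible x y z
  rw [← sub_eq_zero] at h ⊢
  rw [← h]
  abel

theorem balavoine_balavoine_mixed (A : CompatibleLeibnizAlgebra K L) {q : ℕ}
    (h : 1 + q + 1 = q + 2) (h' : 1 + (q + 1) + 1 = q + 1 + 2) (f : Cochain K L (q + 1)) :
    balavoine h' A.π₁ (balavoine h A.π₂ f) + balavoine h' A.π₂ (balavoine h A.π₁ f) = 0 := by
  have H := balavoine_balavoine A.isLeibniz_add h h' f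
  simp only [balavoine_add_left, balavoine_add_right, balavoine_balavoine A.leibniz₁,
    balavoine_balavoine A.leibniz₂, zero_add, add_zero] at H
  rw [← H]
  abel

theorem d_succ_apply (A : CompatibleLeibnizAlgebra K L) {q : ℕ} (f : LC K L (q + 1))
    (i : Fin (q + 2)) :
    A.d (q + 1) f i = (-1 : K) ^ q •
      ((if hi : 0 < (i : ℕ) then
          balavoineLeft (p := 1) A.π₂ (by omega) (f ⟨i - 1, by omega⟩) else 0) +
        (if hi : (i : ℕ) < q + 1 then
          balavoineLeft (p := 1) A.π₁ (by omega) (f ⟨i, hi⟩) else 0)) := rfl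

theorem d_comp_d (A : CompatibleLeibnizAlgebra K L) (n : ℕ) : A.d (n + 1) ∘ₗ A.d n = 0 := by
  cases n with
  | zero => simp [d]
  | succ q =>
    have h : 1 + q + 1 = q + 2 := by omega
    have h' : 1 + (q + 1) + 1 = q + 1 + 2 := by omega
    have h₁ (g : Cochain K L (q + 1)) : balavoineLeft (p := 1) A.π₁ h'
      (balavoineLeft (p := 1) A.π₁ h g) = 0 := balavoine_balavoine A.leibniz₁ h h' g
    have h₂ (g : Cochain K L (q + 1)) : balavoineLeft (p := 1) A.π₂ h'
      (balavoineLeft (p := 1) A.π₂ h g) = 0 := balavoine_balavoine A.leibniz₂ h h' g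
    have h₁₂ (g : Cochain K L (q + 1)) : balavoineLeft (p := 1) A.π₂ h'
        (balavoineLeft (p := 1) A.π₁ h g) + balavoineLeft (p := 1) A.π₁ h'
        (balavoineLeft (p := 1) A.π₂ h g) = 0 :=
      (add_comm _ _).trans (A.balavoine_balavoine_mixed h h' g)
    refine LinearMap.ext fun f => funext fun i => ?_
    simp only [LinearMap.comp_apply, LinearMap.zero_apply, Pi.zero_apply, d_succ_apply]
    -- Component `i` involves `π₂π₂` on `f_{i-2}`, the mixed pair on `f_{i-1}` and `π₁π₁` on `f_i`;
    -- the case split covers the ends of the tuple, where some of these are absent.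
    split_ifs <;> try omega
    all_goals simp only [map_smul, map_add, h₁, h₂, zero_add, add_zero, smul_zero]
    all_goals rw [← smul_add, h₁₂, smul_zero, smul_zero]

theorem coboundaries_le_cocycles {K : Type u} {L : Type v} [Field K] [AddCommGroup L] [Module K L]
    (A : CompatibleLeibnizAlgebra K L) (n : ℕ) : A.coboundaries n ≤ A.cocycles n := by
  cases n with
  | zero => exact bot_le
  | succ n => exact LinearMap.range_le_ker_iff.mpr (A.d_comp_d n)

open CategoryTheory CompatibleLeibniz in
/-- The homology of the cochain complex `(LC^*(L, L), d)` is cocycles modulo coboundaries. -/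
noncomputable def homologyEquiv {K : Type u} {L : Type v} [Field K] [AddCommGroup L] [Module K L]
    (A : CompatibleLeibnizAlgebra K L) (hd : ∀ n : ℕ, A.d (n + 1) ∘ₗ A.d n = 0) (n : ℕ) :
    (A.complex hd).homology n ≃ₗ[K] A.Cohomology n :=
  let S := (A.complex hd).sc' (n - 1) n (n + 1)
  -- At `n = 0` both sides are `0`: `prev` defaults to the index itself, and subtraction truncates.
  have hp : (ComplexShape.up ℕ).prev n = n - 1 := by cases n <;> simp
  have hn : (ComplexShape.up ℕ).next n = n + 1 := by simp
  have hg : LinearMap.ker S.g.hom = A.cocycles n := by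
    simp only [S, complex, HomologicalComplex.shortComplexFunctor'_obj_g, CochainComplex.of_d]
    rfl
  have hf : LinearMap.range S.f.hom = A.coboundaries n := by
    cases n with
    | zero =>
      -- Here `S.f` goes from degree `0` to itself; these indices are not related in the shape, so
      -- it vanishes, in accordance with the coboundaries being `⊥`.
      rw [show S.f = 0 from (A.complex hd).shape _ _ (by simp)]
      exact LinearMap.range_zero
    | succ n =>
      rw [show S.f = ModuleCat.ofHom (A.d n) from CochainComplex.of_d
        (fun n => ModuleCat.of K (LC K L n)) (fun n => ModuleCat.ofHom (A.d n)) n]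
      rfl
  let e := ShortComplex.homologyMapIso ((A.complex hd).isoSc' (n - 1) n (n + 1) hp hn) ≪≫
    S.moduleCatHomologyIso
  e.toLinearEquiv ≪≫ₗ Submodule.Quotient.equiv _ _ (LinearEquiv.ofEq _ _ hg) (by
    refine le_antisymm ?_ fun x hx => ?_
    · rintro _ ⟨_, ⟨y, rfl⟩, rfl⟩
      exact hf.le ⟨y, rfl⟩
    · obtain ⟨y, hy⟩ := hf.ge hx
      exact ⟨_, ⟨y, rfl⟩, Subtype.ext hy⟩)

end CompatibleLeibnizAlgebra

theorem mainTheorem2 {K : Type*} {L : Type*} [Field K] [CharZero K] [AddCommGroup L] [Module K L]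
    (A : CompatibleLeibnizAlgebra K L) :
    ∃ hd : ∀ n : ℕ, A.d (n + 1) ∘ₗ A.d n = 0,
      ∀ n : ℕ, A.coboundaries n ≤ A.cocycles n ∧
        Nonempty ((A.complex hd).homology n ≃ₗ[K] A.Cohomology n) := by
  exact ⟨A.d_comp_d, fun n => ⟨A.coboundaries_le_cocycles n, ⟨A.homologyEquiv A.d_comp_d n⟩⟩⟩
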